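/- Let $\mathfrak A$ be a commutative unital $C^\star$-algebra and let $M$ be a smooth (Hausdorff) $n$-manifold. Put $T_pM^{\mathfrak A}=T_pM\otimes_{\mathbb R}\mathfrak A$, with the involution $(u\otimes a)^*=u\otimes a^*$; smooth $\mathfrak A$-vector fields are the smooth sections of $TM^{\mathfrak A}=\bigcup_p T_pM^{\mathfrak A}$. They act on $C^\infty(M,\mathfrak A)$ by $(X\otimes h)(f)=h\cdot Xf$, and their Lie bracket is the commutator of these derivations. Let $\langle\cdot,\cdot\rangle$ be an $\mathfrak A$-valued semi-Riemannian metric on $M$, i.e. a smoothly varying family of maps $T_pM^{\mathfrak A}\times T_pM^{\mathfrak A}\to\mathfrak A$ that are $\mathfrak A$-linear in the first variable and satisfy $\langle y,x\rangle=\langle x,y\rangle^*$ and $\langle x^*,y^*\rangle=\langle x,y\rangle^*$, and that are non-degenerate: $\langle w,x\rangle=0$ for all $w$ implies $x=0$, and every $\mathfrak A$-linear map $T_pM^{\mathfrak A}\to\mathfrak A$ has the form $y\mapsto\langle y,x\rangle$. Let $\nabla$ be its Levi-Civita connection, i.e. the $\mathfrak A$-connection (additive in both arguments, $\nabla_{fX}Y=f\nabla_XY$,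 $\nabla_X(fY)=X(f)Y+f\nabla_XY$ for $f\in C^\infty(M,\mathfrak A)$) with $\nabla_XY-\nabla_YX=[X,Y]$ and $X\langle Y,Z\rangle=\langle\nabla_XY,Z\rangle+\langle Y,\nabla_{X^*}Z\rangle$ for all smooth $\mathfrak A$-vector fields $X,Y,Z$. Let $\mathcal R(X,Y)Z=\nabla_X\nabla_YZ-\nabla_Y\nabla_XZ-\nabla_{[X,Y]}Z$ be its curvature tensor. For $u,v\in T_pM^{\mathfrak A}$ put $\mathcal Q(u,v)=\langle u,u\rangle\langle v,v\rangle-\langle u,v\rangle\langle u,v\rangle^*$. A non-degenerate $\mathfrak A$-tangent plane at $p$ is a free $\mathfrak A$-submodule of rank two of $T_pM^{\mathfrak A}$ with a basis $u,v$ for which $\mathcal Q(u,v)$ is invertible in $\mathfrak A$; its sectional curvature is $$\mathcal K(u,v)=\frac{\langle\mathcal R(u,v)v^*,u\rangle}{\mathcal Q(u,v)}\in\mathfrak A .$$ Assume that, if $n\ge 2$, there is a non-degenerate $\mathfrak A$-tangent plane at every point of $M$. If $M$ has constant sectional curvature $C\in\mathfrak A$, i.e. $\mathcal K(u,v)=C$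 for every $p\in M$ and every basis $u,v$ of every non-degenerate $\mathfrak A$-tangent plane at $p$, then for all $p\in M$ and all $u,v,w\in T_pM^{\mathfrak A}$ $$\mathcal R(u,v)w=C\bigl(\langle v,w^*\rangle u-\langle u,w^*\rangle v\bigr).$$ -/

import Mathlib

open scoped Manifold ContDiff TensorProduct Topology

set_option linter.unusedSectionVars false

noncomputable section

namespace OpMetric

variable {A : Type*} [CommCStarAlgebra A] {n : ℕ} {M : Type*} [TopologicalSpace M]
  [ChartedSpace (EuclideanSpace ℝ (Fin n)) M]

variable (A n) in
/-- The fibre `T_pM ⊗_ℝ A` of the extended tangent bundle, a free `A`-module. The algebra is written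
as the left factor, so that the `A`-module structure is Mathlib's base change. -/
abbrev ATangent (p : M) : Type _ := A ⊗[ℝ] TangentSpace (𝓡 n) p

/-- The action of an `A`-vector field on `A`-valued functions: `(u ⊗ h)(f) = h · df(u)`. -/
def act (X : ∀ p : M, ATangent A n p) (f : M → A) (p : M) : A :=
  LinearMap.liftBaseChange A (mvfderiv (𝓡 n) f p : TangentSpace (𝓡 n) p →ₗ[ℝ] A) (X p)

variable (A n) in
/-- The `i`-th coordinate function of the preferred chart at `p`, viewed as an `A`-valued function. -/
def coord (p : M) (i : Fin n) (q : M) : A :=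
  algebraMap ℝ A (extChartAt (𝓡 n) p q i)

/-- A section of the extended tangent bundle is smooth if its components `X(xⁱ)` in every preferred
chart are smooth `A`-valued functions on the chart domain. -/
def IsSmoothField (X : ∀ p : M, ATangent A n p) : Prop :=
  ∀ (p : M) (i : Fin n),
    ContMDiffOn (𝓡 n) 𝓘(ℝ, A) ∞ (act X (coord A n p i)) (chartAt (EuclideanSpace ℝ (Fin n)) p).source

variable [IsManifold (𝓡 n) ∞ M]

variable (n) in
/-- The coordinate vector `∂/∂xⁱ` at `q` of the preferred chart at `p` (for `q` in its domain). -/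
def coordVec (p : M) (i : Fin n) (q : M) : TangentSpace (𝓡 n) q :=
  (trivializationAt (EuclideanSpace ℝ (Fin n)) (TangentSpace (𝓡 n)) p).symmL ℝ q
    (EuclideanSpace.single i 1)

/-- The partial derivative `∂f/∂xⁱ` in the preferred chart at `p`. -/
def pd (p : M) (i : Fin n) (f : M → A) (q : M) : A :=
  fderiv ℝ (f ∘ (extChartAt (𝓡 n) p).symm) (extChartAt (𝓡 n) p q) (EuclideanSpace.single i 1)

theorem mvfderiv_coordVec {p q : M} (hq : q ∈ (chartAt (EuclideanSpace ℝ (Fin n)) p).source)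
    {f : M → A} (hf : MDifferentiableAt (𝓡 n) 𝓘(ℝ, A) f q) (i : Fin n) :
    mvfderiv (𝓡 n) f q (coordVec n p i q) = pd p i f q := by
  have h1 : (extChartAt (𝓡 n) p).symm (extChartAt (𝓡 n) p q) = q :=
    (extChartAt (𝓡 n) p).left_inv (by simpa using hq)
  have h2 : MDifferentiableWithinAt 𝓘(ℝ, EuclideanSpace ℝ (Fin n)) (𝓡 n)
      (extChartAt (𝓡 n) p).symm (Set.range (𝓡 n)) (extChartAt (𝓡 n) p q) :=
    mdifferentiableWithinAt_extChartAt_symm ((extChartAt (𝓡 n) p).map_source (by simpa using hq))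
  have key := mfderiv_comp_mfderivWithin_of_eq (I := 𝓘(ℝ, EuclideanSpace ℝ (Fin n))) (I' := 𝓡 n)
    (I'' := 𝓘(ℝ, A)) (x := extChartAt (𝓡 n) p q) (g := f) hf h2
    (by simpa using uniqueMDiffWithinAt_univ _) h1
  have e1 : pd p i f q = (mfderivWithin 𝓘(ℝ, EuclideanSpace ℝ (Fin n)) 𝓘(ℝ, A)
      (f ∘ (extChartAt (𝓡 n) p).symm) (Set.range (𝓡 n)) (extChartAt (𝓡 n) p q))
        (EuclideanSpace.single i 1) := by
    rw [ModelWithCorners.range_eq_univ, mfderivWithin_univ, mfderiv_eq_fderiv]; rfl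
  rw [e1, key, coordVec, TangentBundle.symmL_trivializationAt hq]
  rfl

theorem mvfderiv_coord {p q : M} (hq : q ∈ (chartAt (EuclideanSpace ℝ (Fin n)) p).source)
    (i : Fin n) (v : TangentSpace (𝓡 n) q) :
    mvfderiv (𝓡 n) (coord A n p i) q v = algebraMap ℝ A
      (((trivializationAt (EuclideanSpace ℝ (Fin n)) (TangentSpace (𝓡 n)) p).continuousLinearMapAt
        ℝ q v : EuclideanSpace ℝ (Fin n)) i) := by
  have h1 : MDifferentiableAt (𝓡 n) 𝓘(ℝ, EuclideanSpace ℝ (Fin n)) (extChartAt (𝓡 n) p) q :=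
    mdifferentiableAt_extChartAt hq
  let L : EuclideanSpace ℝ (Fin n) →L[ℝ] A :=
    (Algebra.linearMap ℝ A).toContinuousLinearMap ∘L EuclideanSpace.proj i
  have h2 : MDifferentiableAt 𝓘(ℝ, EuclideanSpace ℝ (Fin n)) 𝓘(ℝ, A) L (extChartAt (𝓡 n) p q) :=
    L.differentiableAt.mdifferentiableAt
  have key := mfderiv_comp (I := 𝓡 n) q h2 h1
  rw [TangentBundle.continuousLinearMapAt_trivializationAt hq]
  have e : coord A n p i = L ∘ extChartAt (𝓡 n) p := rfl
  rw [e]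
  have : mvfderiv (𝓡 n) (L ∘ extChartAt (𝓡 n) p) q v
    = (mfderiv (𝓡 n) 𝓘(ℝ, A) (L ∘ extChartAt (𝓡 n) p) q : EuclideanSpace ℝ (Fin n) →L[ℝ] A) v := rfl
  rw [this, key, mfderiv_eq_fderiv, L.fderiv]
  rfl

theorem sum_coordVec {p q : M} (hq : q ∈ (chartAt (EuclideanSpace ℝ (Fin n)) p).source)
    (v : TangentSpace (𝓡 n) q) :
    v = ∑ i, (((trivializationAt (EuclideanSpace ℝ (Fin n)) (TangentSpace (𝓡 n)) p).continuousLinearMapAt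
        ℝ q v : EuclideanSpace ℝ (Fin n)) i) • coordVec n p i q := by
  set T := trivializationAt (EuclideanSpace ℝ (Fin n)) (TangentSpace (𝓡 n) : M → Type _) p
  have h := T.symmL_continuousLinearMapAt (R := ℝ) (b := q) (by simpa [T] using hq) v
  conv_lhs => rw [← h]
  conv_lhs => rw [← (EuclideanSpace.basisFun (Fin n) ℝ).sum_repr (T.continuousLinearMapAt ℝ q v)]
  rw [map_sum]
  simp [coordVec, T]

theorem act_eq_sum (X : ∀ p : M, ATangent A n p) {p q : M}
    (hq : q ∈ (chartAt (EuclideanSpace ℝ (Fin n)) p).source)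
    {f : M → A} (hf : MDifferentiableAt (𝓡 n) 𝓘(ℝ, A) f q) :
    act X f q = ∑ i, act X (coord A n p i) q * pd p i f q := by
  unfold act
  induction X q using TensorProduct.induction_on with
  | zero => simp
  | add x y hx hy => simp only [map_add, hx, hy, add_mul, Finset.sum_add_distrib]
  | tmul a v =>
    simp only [LinearMap.liftBaseChange_tmul, ContinuousLinearMap.coe_coe, mvfderiv_coord hq]
    conv_lhs => rw [sum_coordVec hq v]
    simp only [map_sum, map_smul, mvfderiv_coordVec hq hf, Finset.smul_sum]
    refine Finset.sum_congr rfl fun i _ => ?_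
    rw [Algebra.smul_def (R := ℝ), smul_eq_mul, smul_eq_mul, mul_assoc]

theorem contDiffAt_chart {p q : M} (hq : q ∈ (chartAt (EuclideanSpace ℝ (Fin n)) p).source)
    {f : M → A} (hf : ContMDiffAt (𝓡 n) 𝓘(ℝ, A) ∞ f q) :
    ContDiffAt ℝ ∞ (f ∘ (extChartAt (𝓡 n) p).symm) (extChartAt (𝓡 n) p q) := by
  rw [← contMDiffAt_iff_contDiffAt]
  have h1 : (extChartAt (𝓡 n) p).symm (extChartAt (𝓡 n) p q) = q :=
    (extChartAt (𝓡 n) p).left_inv (by simpa using hq)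
  refine ContMDiffAt.comp _ (by rwa [h1]) ?_
  refine (contMDiffOn_extChartAt_symm p).contMDiffAt ?_
  exact (isOpen_extChartAt_target p).mem_nhds ((extChartAt (𝓡 n) p).map_source (by simpa using hq))

theorem contMDiffAt_pd {p q : M} (hq : q ∈ (chartAt (EuclideanSpace ℝ (Fin n)) p).source)
    {f : M → A} (hf : ContMDiffAt (𝓡 n) 𝓘(ℝ, A) ∞ f q) (i : Fin n) :
    ContMDiffAt (𝓡 n) 𝓘(ℝ, A) ∞ (pd p i f) q := by
  have h := (contDiffAt_chart hq hf).fderiv_right (m := ∞) (by simp)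
  have h2 := h.clm_apply (contDiffAt_const (c := EuclideanSpace.single i (1 : ℝ)))
  exact h2.contMDiffAt.comp q (contMDiffAt_extChartAt' hq)

theorem pd_pd_comm {p q : M} (hq : q ∈ (chartAt (EuclideanSpace ℝ (Fin n)) p).source)
    {f : M → A} (hf : ContMDiffAt (𝓡 n) 𝓘(ℝ, A) ∞ f q) (i j : Fin n) :
    pd p i (pd p j f) q = pd p j (pd p i f) q := by
  have h := contDiffAt_chart hq hf
  have hs : IsSymmSndFDerivAt ℝ (f ∘ (extChartAt (𝓡 n) p).symm) (extChartAt (𝓡 n) p q) :=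
    h.isSymmSndFDerivAt (by simpa using WithTop.coe_le_coe.2 (le_top : (2 : ℕ∞) ≤ ⊤))
  have hd : DifferentiableAt ℝ (fderiv ℝ (f ∘ (extChartAt (𝓡 n) p).symm)) (extChartAt (𝓡 n) p q) :=
    (h.fderiv_right (m := ∞) (by simp)).differentiableAt (by simp)
  have key : ∀ i j, pd p i (pd p j f) q = fderiv ℝ (fderiv ℝ (f ∘ (extChartAt (𝓡 n) p).symm))
      (extChartAt (𝓡 n) p q) (EuclideanSpace.single i 1) (EuclideanSpace.single j 1) := by
    intro i j
    have he : (pd p j f ∘ (extChartAt (𝓡 n) p).symm) =ᶠ[𝓝 (extChartAt (𝓡 n) p q)]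
        fun y => fderiv ℝ (f ∘ (extChartAt (𝓡 n) p).symm) y (EuclideanSpace.single j 1) := by
      filter_upwards [(isOpen_extChartAt_target p).mem_nhds
        ((extChartAt (𝓡 n) p).map_source (by simpa using hq))] with y hy
      simp only [pd, Function.comp_apply, (extChartAt (𝓡 n) p).right_inv hy]
    rw [pd, he.fderiv_eq, fderiv_clm_apply hd (differentiableAt_const _)]
    simp
  rw [key, key, hs.eq]

theorem pd_congr {p q : M} (hq : q ∈ (chartAt (EuclideanSpace ℝ (Fin n)) p).source)
    {f g : M → A} (h : f =ᶠ[𝓝 q] g) (i : Fin n) : pd p i f q = pd p i g q := by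
  have h1 : (extChartAt (𝓡 n) p).symm (extChartAt (𝓡 n) p q) = q :=
    (extChartAt (𝓡 n) p).left_inv (by simpa using hq)
  have h2 : Filter.Tendsto (extChartAt (𝓡 n) p).symm (𝓝 (extChartAt (𝓡 n) p q)) (𝓝 q) := by
    have := continuousAt_extChartAt_symm' (I := 𝓡 n) (x := p) (x' := q) (by simpa using hq)
    unfold ContinuousAt at this
    rwa [h1] at this
  have : (f ∘ (extChartAt (𝓡 n) p).symm) =ᶠ[𝓝 (extChartAt (𝓡 n) p q)]
    (g ∘ (extChartAt (𝓡 n) p).symm) := h2.eventually h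
  rw [pd, pd, this.fderiv_eq]

theorem pd_sum_mul {p q : M} (hq : q ∈ (chartAt (EuclideanSpace ℝ (Fin n)) p).source)
    {ι : Type*} (s : Finset ι) {f g : ι → M → A}
    (hf : ∀ k ∈ s, ContMDiffAt (𝓡 n) 𝓘(ℝ, A) ∞ (f k) q)
    (hg : ∀ k ∈ s, ContMDiffAt (𝓡 n) 𝓘(ℝ, A) ∞ (g k) q) (i : Fin n) :
    pd p i (fun x => ∑ k ∈ s, f k x * g k x) q
      = ∑ k ∈ s, (pd p i (f k) q * g k q + f k q * pd p i (g k) q) := by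
  have h1 : (extChartAt (𝓡 n) p).symm (extChartAt (𝓡 n) p q) = q :=
    (extChartAt (𝓡 n) p).left_inv (by simpa using hq)
  have hf' := fun k hk => (contDiffAt_chart hq (hf k hk)).differentiableAt (by simp)
  have hg' := fun k hk => (contDiffAt_chart hq (hg k hk)).differentiableAt (by simp)
  have e : ((fun x => ∑ k ∈ s, f k x * g k x) ∘ (extChartAt (𝓡 n) p).symm)
    = fun y => ∑ k ∈ s, (f k ∘ (extChartAt (𝓡 n) p).symm) y * (g k ∘ (extChartAt (𝓡 n) p).symm) y := rfl
  rw [pd, e, fderiv_fun_sum (fun k hk => (hf' k hk).fun_mul (hg' k hk))]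
  rw [_root_.sum_apply]
  refine Finset.sum_congr rfl fun k hk => ?_
  rw [fderiv_fun_mul (hf' k hk) (hg' k hk)]
  simp only [pd, _root_.add_apply, _root_.smul_apply, Function.comp_apply, h1,
    smul_eq_mul]
  ring

theorem eventually_act_eq (X : ∀ p : M, ATangent A n p) {p q : M}
    (hq : q ∈ (chartAt (EuclideanSpace ℝ (Fin n)) p).source)
    {f : M → A} (hf : ContMDiffAt (𝓡 n) 𝓘(ℝ, A) ∞ f q) :
    act X f =ᶠ[𝓝 q] fun x => ∑ i, act X (coord A n p i) x * pd p i f x := by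
  have h1 : ∀ᶠ x in 𝓝 q, ContMDiffAt (𝓡 n) 𝓘(ℝ, A) 1 f x :=
    contMDiffAt_iff_contMDiffAt_nhds (by simp) |>.1 (hf.of_le (by exact_mod_cast le_top))
  filter_upwards [h1, (chartAt (EuclideanSpace ℝ (Fin n)) p).open_source.mem_nhds hq] with x hx hx'
  exact act_eq_sum X hx' (hx.mdifferentiableAt (by simp))

theorem IsSmoothField.contMDiffAt_coord {X : ∀ p : M, ATangent A n p} (hX : IsSmoothField X)
    {p q : M} (hq : q ∈ (chartAt (EuclideanSpace ℝ (Fin n)) p).source) (i : Fin n) :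
    ContMDiffAt (𝓡 n) 𝓘(ℝ, A) ∞ (act X (coord A n p i)) q :=
  (hX p i).contMDiffAt ((chartAt (EuclideanSpace ℝ (Fin n)) p).open_source.mem_nhds hq)

theorem contMDiffAt_mul {f g : M → A} {q : M} (hf : ContMDiffAt (𝓡 n) 𝓘(ℝ, A) ∞ f q)
    (hg : ContMDiffAt (𝓡 n) 𝓘(ℝ, A) ∞ g q) :
    ContMDiffAt (𝓡 n) 𝓘(ℝ, A) ∞ (fun x => f x * g x) q := by
  have h : ContDiff ℝ ∞ (fun x : A × A => x.1 * x.2) := contDiff_fst.mul contDiff_snd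
  exact h.contMDiff.contMDiffAt.comp q (hf.prodMk_space hg)

theorem contMDiffAt_act {X : ∀ p : M, ATangent A n p} (hX : IsSmoothField X) {q : M}
    {f : M → A} (hf : ContMDiffAt (𝓡 n) 𝓘(ℝ, A) ∞ f q) :
    ContMDiffAt (𝓡 n) 𝓘(ℝ, A) ∞ (act X f) q := by
  have hq := mem_chart_source (EuclideanSpace ℝ (Fin n)) q
  refine ContMDiffAt.congr_of_eventuallyEq ?_ (eventually_act_eq X hq hf)
  refine ContMDiffAt.sum fun i _ => ?_
  exact contMDiffAt_mul (hX.contMDiffAt_coord hq i) (contMDiffAt_pd hq hf i)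

theorem contMDiffAt_coord {p q : M} (hq : q ∈ (chartAt (EuclideanSpace ℝ (Fin n)) p).source)
    (i : Fin n) : ContMDiffAt (𝓡 n) 𝓘(ℝ, A) ∞ (coord A n p i) q := by
  let L : EuclideanSpace ℝ (Fin n) →L[ℝ] A :=
    (Algebra.linearMap ℝ A).toContinuousLinearMap ∘L EuclideanSpace.proj i
  exact L.contMDiff.contMDiffAt.comp q (contMDiffAt_extChartAt' hq)

/-- The Lie bracket of `A`-vector fields, in coordinates
`[X, Y] = ∑ᵢ (X(Y(xⁱ)) - Y(X(xⁱ))) ∂/∂xⁱ`. By `act_bracketFun` it is the commutator of the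
derivations given by `X` and `Y`. -/
def bracketFun (X Y : ∀ p : M, ATangent A n p) (p : M) : ATangent A n p :=
  ∑ i, (act X (act Y (coord A n p i)) p - act Y (act X (coord A n p i)) p) ⊗ₜ[ℝ] coordVec n p i p

theorem act_act {X Y : ∀ p : M, ATangent A n p} (hY : IsSmoothField Y)
    {p q : M} (hq : q ∈ (chartAt (EuclideanSpace ℝ (Fin n)) p).source)
    {f : M → A} (hf : ContMDiffAt (𝓡 n) 𝓘(ℝ, A) ∞ f q) :
    act X (act Y f) q = ∑ j, act X (act Y (coord A n p j)) q * pd p j f q +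
      ∑ i, ∑ j, act X (coord A n p i) q * act Y (coord A n p j) q * pd p i (pd p j f) q := by
  rw [act_eq_sum X hq ((contMDiffAt_act hY hf).mdifferentiableAt (by simp))]
  have h : ∀ i : Fin n, pd p i (act Y f) q = ∑ j, (pd p i (act Y (coord A n p j)) q * pd p j f q +
      act Y (coord A n p j) q * pd p i (pd p j f) q) := by
    intro i
    rw [pd_congr hq (eventually_act_eq Y hq hf),
      pd_sum_mul hq _ (fun j _ => hY.contMDiffAt_coord hq j) (fun j _ => contMDiffAt_pd hq hf j)]
  have h2 : ∀ j : Fin n, act X (act Y (coord A n p j)) q =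
      ∑ i, act X (coord A n p i) q * pd p i (act Y (coord A n p j)) q := fun j =>
    act_eq_sum X hq ((hY.contMDiffAt_coord hq j).mdifferentiableAt (by simp))
  simp only [h, h2, Finset.mul_sum, Finset.sum_mul]
  rw [Finset.sum_comm (f := fun j i => act X (coord A n p i) q *
    pd p i (act Y (coord A n p j)) q * pd p j f q), ← Finset.sum_add_distrib]
  refine Finset.sum_congr rfl fun i _ => ?_
  rw [← Finset.sum_add_distrib]
  refine Finset.sum_congr rfl fun j _ => ?_
  ring

theorem act_bracketFun {X Y : ∀ p : M, ATangent A n p} (hX : IsSmoothField X)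
    (hY : IsSmoothField Y) {q : M} {f : M → A} (hf : ContMDiffAt (𝓡 n) 𝓘(ℝ, A) ∞ f q) :
    act (bracketFun X Y) f q = act X (act Y f) q - act Y (act X f) q := by
  have hq := mem_chart_source (EuclideanSpace ℝ (Fin n)) q
  have hd := hf.mdifferentiableAt (by simp)
  rw [act_act hY hq hf, act_act hX hq hf]
  have e : ∑ i, ∑ j, act X (coord A n q i) q * act Y (coord A n q j) q * pd q i (pd q j f) q
      = ∑ i, ∑ j, act Y (coord A n q i) q * act X (coord A n q j) q * pd q i (pd q j f) q := by
    rw [Finset.sum_comm]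
    refine Finset.sum_congr rfl fun i _ => Finset.sum_congr rfl fun j _ => ?_
    rw [pd_pd_comm hq hf]; ring
  rw [e, add_sub_add_right_eq_sub, ← Finset.sum_sub_distrib]
  simp only [act, bracketFun, map_sum, LinearMap.liftBaseChange_tmul, ContinuousLinearMap.coe_coe,
    mvfderiv_coordVec hq hd, smul_eq_mul, sub_mul]

theorem act_add (X Y : ∀ p : M, ATangent A n p) (f : M → A) :
    act (X + Y) f = act X f + act Y f := by
  funext p; simp [act]

theorem act_smul (g : M → A) (X : ∀ p : M, ATangent A n p) (f : M → A) (p : M) :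
    act (fun p => g p • X p) f p = g p * act X f p := by
  simp only [act, map_smul, smul_eq_mul]

/-- The involution `(u ⊗ a)* = u ⊗ a*` on `A ⊗ V`. -/
def conj {V : Type*} [AddCommGroup V] [Module ℝ V] : A ⊗[ℝ] V →ₗ[ℝ] A ⊗[ℝ] V :=
  LinearMap.rTensor V ((starL' ℝ : A ≃L[ℝ] A) : A →ₗ[ℝ] A)

theorem act_conj_coord (X : ∀ p : M, ATangent A n p) {p q : M}
    (hq : q ∈ (chartAt (EuclideanSpace ℝ (Fin n)) p).source) (i : Fin n) :
    act (fun p => conj (X p)) (coord A n p i) q = star (act X (coord A n p i) q) := by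
  unfold act
  simp only
  generalize X q = x
  induction x using TensorProduct.induction_on with
  | zero => simp
  | add x y hx hy => simp only [map_add, hx, hy, star_add]
  | tmul a v =>
    simp [conj, mvfderiv_coord hq, ← algebraMap_star_comm (R := ℝ)]

theorem isSmoothField_smul {f : M → A} (hf : ContMDiff (𝓡 n) 𝓘(ℝ, A) ∞ f)
    {X : ∀ p : M, ATangent A n p} (hX : IsSmoothField X) :
    IsSmoothField (fun p => f p • X p) := by
  intro p i q hq
  have : act (fun p => f p • X p) (coord A n p i) = fun q => f q * act X (coord A n p i) q := by
    funext q; exact act_smul f X _ q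
  rw [this]
  exact (contMDiffAt_mul hf.contMDiffAt (hX.contMDiffAt_coord hq i)).contMDiffWithinAt

theorem isSmoothField_zero : IsSmoothField (0 : ∀ p : M, ATangent A n p) := by
  intro p i
  have : act (0 : ∀ p : M, ATangent A n p) (coord A n p i) = fun _ => 0 := by
    funext q; simp [act]
  rw [this]; exact contMDiffOn_const

theorem isSmoothField_add {X Y : ∀ p : M, ATangent A n p} (hX : IsSmoothField X)
    (hY : IsSmoothField Y) : IsSmoothField (X + Y) := by
  intro p i
  rw [act_add]; exact (hX p i).add (hY p i)

theorem isSmoothField_const_smul (a : A) {X : ∀ p : M, ATangent A n p} (hX : IsSmoothField X) :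
    IsSmoothField (a • X) :=
  isSmoothField_smul (f := fun _ => a) contMDiff_const hX

variable (A n M) in
/-- The smooth `A`-vector fields on `M`. -/
@[ext]
structure AVectorField where
  toFun : ∀ p : M, ATangent A n p
  smooth : IsSmoothField toFun

variable (A n M) in
/-- The smooth functions `M → A`. -/
abbrev SmoothFun := C^∞⟮𝓡 n, M; 𝓘(ℝ, A), A⟯

namespace AVectorField

instance : CoeFun (AVectorField A n M) fun _ => ∀ p : M, ATangent A n p := ⟨toFun⟩

instance : Zero (AVectorField A n M) := ⟨⟨0, isSmoothField_zero⟩⟩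

instance : Add (AVectorField A n M) := ⟨fun X Y => ⟨X.1 + Y.1, isSmoothField_add X.2 Y.2⟩⟩

instance : SMul A (AVectorField A n M) := ⟨fun a X => ⟨a • X.1, isSmoothField_const_smul a X.2⟩⟩

instance : Neg (AVectorField A n M) := ⟨fun X => ⟨-X.1, by
  have h : -X.1 = (-1 : A) • X.1 := funext fun p => (neg_one_smul A (X.1 p)).symm
  rw [h]; exact isSmoothField_const_smul (-1) X.2⟩⟩

instance : Sub (AVectorField A n M) := ⟨fun X Y => ⟨X.1 - Y.1, by
  rw [sub_eq_add_neg]; exact isSmoothField_add X.2 (-Y).2⟩⟩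

instance : SMul ℕ (AVectorField A n M) := ⟨fun k X => ⟨k • X.1, by
  have h : k • X.1 = (k : A) • X.1 := funext fun p => (Nat.cast_smul_eq_nsmul A k (X.1 p)).symm
  rw [h]; exact isSmoothField_const_smul (k : A) X.2⟩⟩

instance : SMul ℤ (AVectorField A n M) := ⟨fun k X => ⟨k • X.1, by
  have h : k • X.1 = (k : A) • X.1 := funext fun p => (Int.cast_smul_eq_zsmul A k (X.1 p)).symm
  rw [h]; exact isSmoothField_const_smul (k : A) X.2⟩⟩

instance : AddCommGroup (AVectorField A n M) :=
  Function.Injective.addCommGroup toFun (fun _ _ h => AVectorField.ext h) rfl (fun _ _ => rfl)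
    (fun _ => rfl) (fun _ _ => rfl) (fun _ _ => rfl) (fun _ _ => rfl)

/-- The module structure over the smooth `A`-valued functions. -/
instance : SMul (SmoothFun A n M) (AVectorField A n M) :=
  ⟨fun f X => ⟨fun p => f p • X p, isSmoothField_smul f.contMDiff X.2⟩⟩

end AVectorField

/-- The involution on smooth `A`-vector fields. -/
def AVectorField.conj (X : AVectorField A n M) : AVectorField A n M :=
  ⟨fun p => OpMetric.conj (X.1 p), fun p i => by
    have h : ContMDiffOn (𝓡 n) 𝓘(ℝ, A) ∞ (fun q => star (act X.1 (coord A n p i) q))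
        (chartAt (EuclideanSpace ℝ (Fin n)) p).source :=
      ((starL' ℝ : A ≃L[ℝ] A) : A →L[ℝ] A).contMDiff.comp_contMDiffOn (X.2 p i)
    exact h.congr fun q hq => act_conj_coord X.1 hq i⟩

/-- The smooth function `X(f)`. -/
def AVectorField.apply (X : AVectorField A n M) (f : SmoothFun A n M) : SmoothFun A n M :=
  ⟨act X.1 f, fun _ => contMDiffAt_act X.2 f.contMDiff.contMDiffAt⟩

/-- The Lie bracket of smooth `A`-vector fields. -/
def AVectorField.bracket (X Y : AVectorField A n M) : AVectorField A n M :=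
  ⟨bracketFun X.1 Y.1, fun p i q hq => by
    have h : ContMDiffOn (𝓡 n) 𝓘(ℝ, A) ∞ (fun q => act X.1 (act Y.1 (coord A n p i)) q -
        act Y.1 (act X.1 (coord A n p i)) q) (chartAt (EuclideanSpace ℝ (Fin n)) p).source :=
      fun q hq => ((contMDiffAt_act X.2 (Y.2.contMDiffAt_coord hq i)).sub
        (contMDiffAt_act Y.2 (X.2.contMDiffAt_coord hq i))).contMDiffWithinAt
    exact h.congr (fun q hq => act_bracketFun X.2 Y.2 (contMDiffAt_coord hq i)) q hq⟩

variable (n) in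
/-- A smooth bump function that is `1` near `p` and supported in the preferred chart at `p`. -/
def bump (p : M) : SmoothBumpFunction (𝓡 n) p := Classical.arbitrary _

/-- The vector `u` at `p`, extended with constant coefficients in the chart at `p` and cut off. -/
def extendFun [T2Space M] (p : M) (u : ATangent A n p) (q : M) : ATangent A n q :=
  algebraMap ℝ A (bump n p q) • LinearMap.baseChange A
    (((trivializationAt (EuclideanSpace ℝ (Fin n)) (TangentSpace (𝓡 n)) p).symmL ℝ q ∘L
      (trivializationAt (EuclideanSpace ℝ (Fin n)) (TangentSpace (𝓡 n)) p).continuousLinearMapAt ℝ p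
      : TangentSpace (𝓡 n) p →L[ℝ] TangentSpace (𝓡 n) q) : TangentSpace (𝓡 n) p →ₗ[ℝ] TangentSpace (𝓡 n) q) u

theorem extendFun_self [T2Space M] (p : M) (u : ATangent A n p) : extendFun p u p = u := by
  have h : ((trivializationAt (EuclideanSpace ℝ (Fin n)) (TangentSpace (𝓡 n)) p).symmL ℝ p ∘L
      (trivializationAt (EuclideanSpace ℝ (Fin n)) (TangentSpace (𝓡 n)) p).continuousLinearMapAt ℝ p
      : TangentSpace (𝓡 n) p →L[ℝ] TangentSpace (𝓡 n) p) = ContinuousLinearMap.id ℝ _ := by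
    ext1 v
    exact Bundle.Trivialization.symmL_continuousLinearMapAt _ (by simp) v
  rw [extendFun, h, SmoothBumpFunction.eq_one]
  simp

theorem act_extendFun_tmul [T2Space M] (p : M) (a : A) (v : TangentSpace (𝓡 n) p) {f : M → A} {q : M}
    (hq : q ∈ (chartAt (EuclideanSpace ℝ (Fin n)) p).source)
    (hf : MDifferentiableAt (𝓡 n) 𝓘(ℝ, A) f q) :
    act (extendFun p (a ⊗ₜ v)) f q = (bump n p) q •
      (a * ∑ i, ((trivializationAt (EuclideanSpace ℝ (Fin n)) (TangentSpace (𝓡 n)) p).continuousLinearMapAt ℝ p v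
        : EuclideanSpace ℝ (Fin n)) i • pd p i f q) := by
  set T := trivializationAt (EuclideanSpace ℝ (Fin n)) (TangentSpace (𝓡 n) : M → Type _) p
  have e : T.symmL ℝ q (T.continuousLinearMapAt ℝ p v) =
      ∑ i, (T.continuousLinearMapAt ℝ p v : EuclideanSpace ℝ (Fin n)) i • coordVec n p i q := by
    conv_lhs => rw [← (EuclideanSpace.basisFun (Fin n) ℝ).sum_repr (T.continuousLinearMapAt ℝ p v)]
    rw [map_sum]
    simp [coordVec, T]
  rw [act, extendFun, map_smul, LinearMap.baseChange_tmul, LinearMap.liftBaseChange_tmul,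
    algebraMap_smul]
  change (bump n p) q • a • (mvfderiv (𝓡 n) f q) (T.symmL ℝ q (T.continuousLinearMapAt ℝ p v)) = _
  rw [e, map_sum]
  simp only [map_smul, mvfderiv_coordVec hq hf, smul_eq_mul]
  rfl

theorem isSmoothField_extendFun [T2Space M] (p : M) (u : ATangent A n p) :
    IsSmoothField (extendFun p u) := by
  induction u using TensorProduct.induction_on with
  | zero =>
    have : extendFun p (0 : ATangent A n p) = 0 := by funext q; simp [extendFun]
    rw [this]; exact isSmoothField_zero
  | add x y hx hy =>
    have : extendFun p (x + y) = extendFun p x + extendFun p y := by funext q; simp [extendFun]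
    rw [this]; exact isSmoothField_add hx hy
  | tmul a v =>
    intro p' i q hq
    refine ContMDiffAt.contMDiffWithinAt ?_
    by_cases hqp : q ∈ (chartAt (EuclideanSpace ℝ (Fin n)) p).source
    · have h : act (extendFun p (a ⊗ₜ v)) (coord A n p' i) =ᶠ[𝓝 q] fun q => (bump n p) q •
          (a * ∑ j, ((trivializationAt (EuclideanSpace ℝ (Fin n))
            (TangentSpace (𝓡 n)) p).continuousLinearMapAt ℝ p v : EuclideanSpace ℝ (Fin n)) j •
              pd p j (coord A n p' i) q) := by
        filter_upwards [(chartAt (EuclideanSpace ℝ (Fin n)) p).open_source.mem_nhds hqp,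
          (chartAt (EuclideanSpace ℝ (Fin n)) p').open_source.mem_nhds hq] with x hx hx'
        exact act_extendFun_tmul p a v hx ((contMDiffAt_coord hx' i).mdifferentiableAt (by simp))
      refine ContMDiffAt.congr_of_eventuallyEq ?_ h
      refine (SmoothBumpFunction.contMDiffAt _).smul (contMDiffAt_mul contMDiffAt_const ?_)
      refine ContMDiffAt.sum fun j _ => ?_
      simp only [Algebra.smul_def]
      exact contMDiffAt_mul contMDiffAt_const (contMDiffAt_pd hqp (contMDiffAt_coord hq i) j)
    · have h : act (extendFun p (a ⊗ₜ v)) (coord A n p' i) =ᶠ[𝓝 q] fun _ => 0 := by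
        have hs : q ∉ tsupport (bump n p) := fun h =>
          hqp (SmoothBumpFunction.tsupport_subset_chartAt_source _ h)
        filter_upwards [(isClosed_tsupport _).isOpen_compl.mem_nhds hs] with x hx
        simp [act, extendFun, image_eq_zero_of_notMem_tsupport hx]
      exact contMDiffAt_const.congr_of_eventuallyEq h

/-- A smooth `A`-vector field with value `u` at `p` (see `extendFun_self`). -/
def extend [T2Space M] (p : M) (u : ATangent A n p) : AVectorField A n M :=
  ⟨extendFun p u, isSmoothField_extendFun p u⟩

/-- An `A`-valued inner product on an `A`-module; the last two conditions are non-degeneracy. -/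
structure AInnerProduct (A V : Type*) [CommCStarAlgebra A] [AddCommGroup V] [Module A V] where
  inner : V → V → A
  star_inner : ∀ x y, inner y x = star (inner x y)
  inner_smul_add : ∀ (a : A) (x y z : V), inner (a • x + y) z = a * inner x z + inner y z
  eq_zero : ∀ x, (∀ w, inner w x = 0) → x = 0
  exists_rep : ∀ T : V →ₗ[A] A, ∃ x, ∀ y, T y = inner y x

variable (A n M) in
/-- An `A`-valued semi-Riemannian metric on `M`: inner products on the fibres, compatible with the
involution and varying smoothly. -/
structure AMetric where
  ip : ∀ p : M, AInnerProduct A (ATangent A n p)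
  inner_conj : ∀ (p : M) (x y : ATangent A n p),
    (ip p).inner (conj x) (conj y) = star ((ip p).inner x y)
  smooth : ∀ X Y : AVectorField A n M,
    ContMDiff (𝓡 n) 𝓘(ℝ, A) ∞ fun p => (ip p).inner (X.1 p) (Y.1 p)

/-- The smooth function `⟨X, Y⟩`. -/
def AMetric.pair (g : AMetric A n M) (X Y : AVectorField A n M) : SmoothFun A n M :=
  ⟨fun p => (g.ip p).inner (X.1 p) (Y.1 p), g.smooth X Y⟩

variable (A n M) in
/-- An `A`-connection on `M`. -/
structure AConnection where
  cov : AVectorField A n M → AVectorField A n M → AVectorField A n M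
  add_left : ∀ X X' Y, cov (X + X') Y = cov X Y + cov X' Y
  add_right : ∀ X Y Y', cov X (Y + Y') = cov X Y + cov X Y'
  smul_left : ∀ (f : SmoothFun A n M) X Y, cov (f • X) Y = f • cov X Y
  leibniz : ∀ (f : SmoothFun A n M) X Y, cov X (f • Y) = X.apply f • Y + f • cov X Y

/-- The torsion tensor. -/
def AConnection.torsion (D : AConnection A n M) (X Y : AVectorField A n M) : AVectorField A n M :=
  D.cov X Y - D.cov Y X - X.bracket Y

/-- The curvature tensor `R(X, Y)Z` on smooth `A`-vector fields. -/
def AConnection.curvature (D : AConnection A n M) (X Y Z : AVectorField A n M) :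
    AVectorField A n M :=
  D.cov X (D.cov Y Z) - D.cov Y (D.cov X Z) - D.cov (X.bracket Y) Z

/-- `D` is the Levi-Civita connection of `g`: torsion free and compatible with the metric. -/
structure AConnection.IsLeviCivita (D : AConnection A n M) (g : AMetric A n M) : Prop where
  torsion_free : ∀ X Y, D.torsion X Y = 0
  compatible : ∀ (X Y Z : AVectorField A n M) (p : M),
    X.apply (g.pair Y Z) p = g.pair (D.cov X Y) Z p + g.pair Y (D.cov X.conj Z) p

/-- The curvature tensor at `p` on vectors, computed on extensions of the vectors to smooth fields. By
`curvatureAt_apply` any other extensions give the same value. -/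
def AConnection.curvatureAt [T2Space M] (D : AConnection A n M) (p : M) (u v w : ATangent A n p) :
    ATangent A n p :=
  (D.curvature (extend p u) (extend p v) (extend p w)).1 p

/-- `Q(u, v) = ⟨u, u⟩⟨v, v⟩ - ⟨u, v⟩⟨u, v⟩*`. -/
def AMetric.Q (g : AMetric A n M) (p : M) (u v : ATangent A n p) : A :=
  (g.ip p).inner u u * (g.ip p).inner v v - (g.ip p).inner u v * star ((g.ip p).inner u v)

/-- `P` is a non-degenerate `A`-tangent plane at `p`: a free submodule of rank two with a basis
`u, v` for which `Q(u, v)` is invertible. -/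
def AMetric.IsNondegeneratePlane (g : AMetric A n M) (p : M) (P : Submodule A (ATangent A n p)) :
    Prop :=
  ∃ b : Module.Basis (Fin 2) A P, IsUnit (g.Q p (b 0) (b 1))

/-- `K(u, v) = ⟨R(u, v)v*, u⟩ / Q(u, v)`, the sectional curvature of the plane with basis `u, v`. -/
def AMetric.sectionalCurvature [T2Space M] (g : AMetric A n M) (D : AConnection A n M) (p : M)
    (u v : ATangent A n p) : A :=
  (g.ip p).inner (D.curvatureAt p u v (conj v)) u * Ring.inverse (g.Q p u v)

/-- Every non-degenerate `A`-tangent plane to `M` has sectional curvature `C`. -/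
def AMetric.HasConstantCurvature [T2Space M] (g : AMetric A n M) (D : AConnection A n M) (C : A) :
    Prop :=
  ∀ (p : M) (P : Submodule A (ATangent A n p)), g.IsNondegeneratePlane p P →
    ∀ b : Module.Basis (Fin 2) A P, g.sectionalCurvature D p (b 0) (b 1) = C

/-- A vector is determined by its components. -/
theorem eq_sum_tmul (X : ∀ p : M, ATangent A n p) {p q : M}
    (hq : q ∈ (chartAt (EuclideanSpace ℝ (Fin n)) p).source) :
    X q = ∑ i, act X (coord A n p i) q ⊗ₜ[ℝ] coordVec n p i q := by
  unfold act
  generalize X q = x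
  induction x using TensorProduct.induction_on with
  | zero => simp
  | add x y hx hy =>
    simp only [map_add, TensorProduct.add_tmul, Finset.sum_add_distrib]
    rw [← hx, ← hy]
  | tmul a v =>
    conv_lhs => rw [sum_coordVec hq v]
    simp only [LinearMap.liftBaseChange_tmul, ContinuousLinearMap.coe_coe, mvfderiv_coord hq,
      TensorProduct.tmul_sum]
    refine Finset.sum_congr rfl fun i _ => ?_
    rw [TensorProduct.tmul_smul, smul_eq_mul, mul_comm, ← Algebra.smul_def, TensorProduct.smul_tmul']

theorem AVectorField.ext_coord {X Y : AVectorField A n M}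
    (h : ∀ (p : M) (i : Fin n), act X.1 (coord A n p i) p = act Y.1 (coord A n p i) p) : X = Y := by
  apply AVectorField.ext
  funext p
  have hp := mem_chart_source (EuclideanSpace ℝ (Fin n)) p
  rw [eq_sum_tmul X.1 hp, eq_sum_tmul Y.1 hp]
  simp only [h]

theorem act_mul (X : ∀ p : M, ATangent A n p) {f g : M → A} {q : M}
    (hf : ContMDiffAt (𝓡 n) 𝓘(ℝ, A) ∞ f q) (hg : ContMDiffAt (𝓡 n) 𝓘(ℝ, A) ∞ g q) :
    act X (fun x => f x * g x) q = act X f q * g q + f q * act X g q := by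
  have hq := mem_chart_source (EuclideanSpace ℝ (Fin n)) q
  rw [act_eq_sum X hq ((contMDiffAt_mul hf hg).mdifferentiableAt (by simp)),
    act_eq_sum X hq (hf.mdifferentiableAt (by simp)),
    act_eq_sum X hq (hg.mdifferentiableAt (by simp)), Finset.sum_mul, Finset.mul_sum,
    ← Finset.sum_add_distrib]
  refine Finset.sum_congr rfl fun i _ => ?_
  have := pd_sum_mul hq {()} (f := fun _ => f) (g := fun _ => g) (fun _ _ => hf) (fun _ _ => hg) i
  simp only [Finset.sum_singleton] at this
  rw [this]; ring

theorem bracket_smul_left (f : SmoothFun A n M) (X Y : AVectorField A n M) :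
    (f • X).bracket Y = f • X.bracket Y - Y.apply f • X := by
  apply AVectorField.ext_coord
  intro p i
  have hp := mem_chart_source (EuclideanSpace ℝ (Fin n)) p
  have hc := contMDiffAt_coord (A := A) hp i
  have h1 : act ((f • X).bracket Y).1 (coord A n p i) p = _ :=
    act_bracketFun (f • X).2 Y.2 hc
  have h2 : act (X.bracket Y).1 (coord A n p i) p = _ := act_bracketFun X.2 Y.2 hc
  have h3 : ∀ g, act (f • X).1 g = fun q => f q * act X.1 g q := fun g => by
    funext q; exact act_smul f X.1 g q
  have h4 : act (f • X.bracket Y - Y.apply f • X).1 (coord A n p i) p =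
      f p * act (X.bracket Y).1 (coord A n p i) p - act Y.1 f p * act X.1 (coord A n p i) p := by
    simp only [act]
    exact (map_sub _ _ _).trans (congrArg₂ _ (map_smul _ _ _) (map_smul _ _ _))
  rw [h1, h4, h2, h3, h3, act_mul Y.1 f.contMDiff.contMDiffAt (X.2.contMDiffAt_coord hp i)]
  ring

theorem bracket_swap (X Y : AVectorField A n M) : X.bracket Y = - Y.bracket X := by
  apply AVectorField.ext
  funext p
  change bracketFun X.1 Y.1 p = - bracketFun Y.1 X.1 p
  simp only [bracketFun, ← Finset.sum_neg_distrib, ← TensorProduct.neg_tmul, neg_sub]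

theorem apply_bracket (X Y : AVectorField A n M) (f : SmoothFun A n M) (p : M) :
    (X.bracket Y).apply f p = X.apply (Y.apply f) p - Y.apply (X.apply f) p :=
  act_bracketFun X.2 Y.2 f.contMDiff.contMDiffAt

theorem smul_apply_field (f : SmoothFun A n M) (X : AVectorField A n M) (p : M) :
    (f • X).1 p = f p • X.1 p := rfl

namespace AConnection

variable (D : AConnection A n M)

theorem cov_zero_left (Y : AVectorField A n M) : D.cov 0 Y = 0 := by
  have := D.add_left 0 0 Y
  simpa using this

theorem cov_neg_left (X Y : AVectorField A n M) : D.cov (-X) Y = - D.cov X Y := by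
  have := D.add_left (-X) X Y
  rw [neg_add_cancel, cov_zero_left] at this
  exact eq_neg_of_add_eq_zero_left this.symm

theorem cov_sub_left (X X' Y : AVectorField A n M) : D.cov (X - X') Y = D.cov X Y - D.cov X' Y := by
  rw [sub_eq_add_neg, D.add_left, cov_neg_left, ← sub_eq_add_neg]

theorem curvature_swap (X Y Z : AVectorField A n M) : D.curvature X Y Z = - D.curvature Y X Z := by
  simp only [curvature]
  rw [bracket_swap X Y, cov_neg_left]
  abel

theorem curvature_smul_left (f : SmoothFun A n M) (X Y Z : AVectorField A n M) :
    D.curvature (f • X) Y Z = f • D.curvature X Y Z := by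
  simp only [curvature]
  rw [bracket_smul_left, cov_sub_left, D.smul_left, D.smul_left, D.smul_left, D.smul_left,
    D.leibniz]
  apply AVectorField.ext
  funext p
  change f p • _ - (act Y.1 f p • _ + f p • _) - (f p • _ - act Y.1 f p • _) = f p • ((_ : ATangent A n p) - _ - _)
  module

theorem curvature_smul_mid (f : SmoothFun A n M) (X Y Z : AVectorField A n M) :
    D.curvature X (f • Y) Z = f • D.curvature X Y Z := by
  rw [curvature_swap, curvature_smul_left, D.curvature_swap X Y]
  apply AVectorField.ext
  funext p
  exact (smul_neg _ _).symm

theorem curvature_smul_right (f : SmoothFun A n M) (X Y Z : AVectorField A n M) :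
    D.curvature X Y (f • Z) = f • D.curvature X Y Z := by
  simp only [curvature]
  rw [D.leibniz, D.leibniz, D.leibniz, D.add_right, D.add_right, D.leibniz, D.leibniz, D.leibniz,
    D.leibniz]
  apply AVectorField.ext
  funext p
  have h := apply_bracket X Y f p
  change (X.apply (Y.apply f) p • Z.1 p + Y.apply f p • (D.cov X Z).1 p +
      (X.apply f p • (D.cov Y Z).1 p + f p • (D.cov X (D.cov Y Z)).1 p)) -
    (Y.apply (X.apply f) p • Z.1 p + X.apply f p • (D.cov Y Z).1 p +
      (Y.apply f p • (D.cov X Z).1 p + f p • (D.cov Y (D.cov X Z)).1 p)) -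
    ((X.bracket Y).apply f p • Z.1 p + f p • (D.cov (X.bracket Y) Z).1 p) =
    f p • ((D.cov X (D.cov Y Z)).1 p - (D.cov Y (D.cov X Z)).1 p - (D.cov (X.bracket Y) Z).1 p)
  rw [h]
  module

theorem bracket_add_left (X X' Y : AVectorField A n M) :
    (X + X').bracket Y = X.bracket Y + X'.bracket Y := by
  apply AVectorField.ext_coord
  intro p i
  have hp := mem_chart_source (EuclideanSpace ℝ (Fin n)) p
  have hc := contMDiffAt_coord (A := A) hp i
  have h1 : act ((X + X').bracket Y).1 (coord A n p i) p = _ := act_bracketFun (X + X').2 Y.2 hc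
  have h2 : act (X.bracket Y).1 (coord A n p i) p = _ := act_bracketFun X.2 Y.2 hc
  have h3 : act (X'.bracket Y).1 (coord A n p i) p = _ := act_bracketFun X'.2 Y.2 hc
  have h4 : ∀ (X X' : AVectorField A n M) g, act (X + X').1 g = act X.1 g + act X'.1 g :=
    fun X X' g => act_add X.1 X'.1 g
  have h5 : act Y.1 (act X.1 (coord A n p i) + act X'.1 (coord A n p i)) p
      = act Y.1 (act X.1 (coord A n p i)) p + act Y.1 (act X'.1 (coord A n p i)) p := by
    rw [act, mvfderiv_add ((X.2.contMDiffAt_coord hp i).mdifferentiableAt (by simp))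
      ((X'.2.contMDiffAt_coord hp i).mdifferentiableAt (by simp))]
    simp only [ContinuousLinearMap.toLinearMap_add, map_add]
    rfl
  rw [h1, h4, h4, h4, Pi.add_apply, Pi.add_apply, h2, h3, h5]
  ring

theorem curvature_add_left (X X' Y Z : AVectorField A n M) :
    D.curvature (X + X') Y Z = D.curvature X Y Z + D.curvature X' Y Z := by
  simp only [curvature, bracket_add_left, D.add_left, D.add_right]
  abel

theorem curvature_add_mid (X Y Y' Z : AVectorField A n M) :
    D.curvature X (Y + Y') Z = D.curvature X Y Z + D.curvature X Y' Z := by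
  rw [curvature_swap, curvature_add_left, D.curvature_swap X Y, D.curvature_swap X Y', neg_add]

theorem curvature_add_right (X Y Z Z' : AVectorField A n M) :
    D.curvature X Y (Z + Z') = D.curvature X Y Z + D.curvature X Y Z' := by
  simp only [curvature, D.add_right]
  abel

end AConnection

variable [T2Space M]

/-- A map that is linear over the smooth functions is pointwise. -/
theorem tensorial (F : AVectorField A n M → AVectorField A n M)
    (hadd : ∀ X Y, F (X + Y) = F X + F Y)
    (hsmul : ∀ (f : SmoothFun A n M) X, F (f • X) = f • F X)
    {X Y : AVectorField A n M} {p : M} (h : X.1 p = Y.1 p) : (F X).1 p = (F Y).1 p := by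
  have hp := mem_chart_source (EuclideanSpace ℝ (Fin n)) p
  let e : Fin n → AVectorField A n M := fun i => extend p ((1 : A) ⊗ₜ coordVec n p i p)
  let χ : SmoothFun A n M := ⟨fun q => algebraMap ℝ A (bump n p q), by
    exact ((Algebra.linearMap ℝ A).toContinuousLinearMap).contMDiff.comp (bump n p).contMDiff⟩
  have hχ : χ p = 1 := by
    change algebraMap ℝ A (bump n p p) = 1
    rw [SmoothBumpFunction.eq_one]; simp
  let c : AVectorField A n M → Fin n → SmoothFun A n M := fun X i =>
    ⟨fun q => bump n p q • act X.1 (coord A n p i) q, (bump n p).contMDiff_smul (X.2 p i)⟩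
  have hF0 : F 0 = 0 := by simpa using hadd 0 0
  have hsum : ∀ (s : Finset (Fin n)) (G : Fin n → AVectorField A n M),
      F (∑ i ∈ s, G i) = ∑ i ∈ s, F (G i) := by
    intro s G
    induction s using Finset.cons_induction with
    | empty => simpa using hF0
    | cons a s ha ih => rw [Finset.sum_cons, Finset.sum_cons, hadd, ih]
  have hcoe : ∀ (s : Finset (Fin n)) (G : Fin n → AVectorField A n M) (q : M),
      (∑ i ∈ s, G i).1 q = ∑ i ∈ s, (G i).1 q := by
    intro s G q
    induction s using Finset.cons_induction with
    | empty => rfl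
    | cons a s ha ih => rw [Finset.sum_cons, Finset.sum_cons, ← ih]; rfl
  have hcp : ∀ X i q, c X i q = bump n p q • act X.1 (coord A n p i) q := fun _ _ _ => rfl
  have hχq : ∀ q, χ q = algebraMap ℝ A (bump n p q) := fun _ => rfl
  have hdec : ∀ X : AVectorField A n M, χ • χ • X = ∑ i, c X i • e i := by
    intro X
    apply AVectorField.ext
    funext q
    have hr : (∑ i, c X i • e i : AVectorField A n M).1 q = ∑ i, c X i q • (e i).1 q := by
      exact hcoe _ _ _
    rw [hr]
    by_cases hq : q ∈ (chartAt (EuclideanSpace ℝ (Fin n)) p).source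
    · have he : ∀ i, (e i).1 q = χ q • ((1 : A) ⊗ₜ coordVec n p i q) := by
        intro i
        change extendFun p ((1 : A) ⊗ₜ coordVec n p i p) q = _
        rw [extendFun, LinearMap.baseChange_tmul]
        congr 2
        have := Bundle.Trivialization.continuousLinearMapAt_symmL
          (trivializationAt (EuclideanSpace ℝ (Fin n)) (TangentSpace (𝓡 n) : M → Type _) p)
          (R := ℝ) (b := p) (by simp) (EuclideanSpace.single i 1)
        exact congrArg ((trivializationAt (EuclideanSpace ℝ (Fin n)) (TangentSpace (𝓡 n)) p).symmL
          ℝ q) this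
      change χ q • χ q • X.1 q = _
      rw [eq_sum_tmul X.1 hq, Finset.smul_sum, Finset.smul_sum]
      refine Finset.sum_congr rfl fun i _ => ?_
      rw [he]
      rw [hcp, Algebra.smul_def, ← hχq]
      simp only [TensorProduct.smul_tmul', smul_eq_mul]
      congr 1
      ring
    · have h0 : bump n p q = 0 := by
        by_contra hne
        exact hq ((bump n p).support_subset_source hne)
      have h1 : χ q = 0 := by
        change algebraMap ℝ A (bump n p q) = 0
        rw [h0, map_zero]
      have h2 : ∀ i, c X i q = 0 := fun i => by
        rw [hcp, h0, zero_smul]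
      change χ q • χ q • X.1 q = _
      simp [h1, h2]
  have key : ∀ X : AVectorField A n M, (F X).1 p = ∑ i, act X.1 (coord A n p i) p • (F (e i)).1 p := by
    intro X
    have h1 : F (χ • χ • X) = ∑ i, c X i • F (e i) := by
      rw [hdec, hsum]; simp only [hsmul]
    rw [hsmul, hsmul] at h1
    have h2 := congrArg (fun X : AVectorField A n M => X.1 p) h1
    have hr : (∑ i, c X i • F (e i) : AVectorField A n M).1 p = ∑ i, c X i p • (F (e i)).1 p := by
      exact hcoe _ _ _
    simp only [smul_apply_field, hχ, one_smul, hr] at h2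
    rw [h2]
    refine Finset.sum_congr rfl fun i _ => ?_
    rw [hcp, SmoothBumpFunction.eq_one, one_smul]
  rw [key, key]
  simp only [act, h]

theorem AConnection.curvatureAt_apply (D : AConnection A n M) (X Y Z : AVectorField A n M) (p : M) :
    D.curvatureAt p (X.1 p) (Y.1 p) (Z.1 p) = (D.curvature X Y Z).1 p := by
  have h : ∀ X : AVectorField A n M, (extend p (X.1 p)).1 p = X.1 p := fun X => extendFun_self p _
  unfold AConnection.curvatureAt
  rw [tensorial (fun W => D.curvature W _ _) (fun _ _ => D.curvature_add_left _ _ _ _)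
      (fun _ _ => D.curvature_smul_left _ _ _ _) (h X),
    tensorial (fun W => D.curvature _ W _) (fun _ _ => D.curvature_add_mid _ _ _ _)
      (fun _ _ => D.curvature_smul_mid _ _ _ _) (h Y),
    tensorial (fun W => D.curvature _ _ W) (fun _ _ => D.curvature_add_right _ _ _ _)
      (fun _ _ => D.curvature_smul_right _ _ _ _) (h Z)]

end OpMetric

end

/-! Subtract the model curvature from the true one and study the defect `F(u,v,w,z) = ⟨R(u,v)w*, z⟩
- C(⟨u,z⟩⟨v,w⟩ - ⟨u,w⟩⟨v,z⟩)`. On the diagonal, `F(u,v,v,u) = ⟨R(u,v)v*, u⟩ - C Q(u,v)`, so constant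
curvature says exactly that `F(u,v,v,u) = 0` whenever `Q(u,v)` is invertible; by Cramer's rule such
a pair is a basis of the plane it spans (`curvatureDefect_eq_zero_of_isUnit`).

The invertibility condition is removed by analytic continuation (`curvatureDefect_diag_eq_zero`).
One pair with invertible `Q` exists by assumption. Join it to an arbitrary pair by a real line: the
diagonal defect is a polynomial in the parameter, and it vanishes near the starting point because
the units of `A` form an open set. Hence it vanishes at the other end as well.

The form `F` is sesquilinear in `(u,z)` and in `(v,w)`, and `A` contains `i`, so two complex
polarizations turn `F(u,v,v,u) = 0` into `F = 0` (`IsSesquilinear.eq_zero_of_diag`,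
`curvatureDefect_eq_zero`). Non-degeneracy of the metric then removes the inner product with `z`.

In dimension at most one every fibre is cyclic over `A`, and both sides vanish because they are
bilinear and alternating in `u, v`. -/

noncomputable section

namespace OpMetric

/-! ### The involution, sesquilinear forms and polarization. -/

/-- The involution on the extended fibre is conjugate linear. -/
theorem conj_smul {A : Type*} [CommCStarAlgebra A] {V : Type*} [AddCommGroup V] [Module ℝ V]
    (a : A) (x : A ⊗[ℝ] V) : conj (a • x) = star a • conj x := by
  induction x using TensorProduct.induction_on with
  | zero => simp
  | add x y hx hy => simp only [smul_add, map_add, hx, hy]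
  | tmul b v => simp [conj, TensorProduct.smul_tmul']

theorem conj_conj {A : Type*} [CommCStarAlgebra A] {V : Type*} [AddCommGroup V] [Module ℝ V]
    (x : A ⊗[ℝ] V) : conj (conj x) = x := by
  induction x using TensorProduct.induction_on with
  | zero => simp
  | add x y hx hy => simp only [map_add, hx, hy]
  | tmul b v => simp [conj]

/-- Sesquilinearity of an `A`-valued form: linear in the first variable and conjugate linear in the
second. -/
structure IsSesquilinear {A V : Type*} [CommCStarAlgebra A] [AddCommGroup V] [Module A V]
    (f : V → V → A) : Prop where
  add_left : ∀ x y z, f (x + y) z = f x z + f y z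
  smul_left : ∀ (a : A) x z, f (a • x) z = a * f x z
  add_right : ∀ x y z, f x (y + z) = f x y + f x z
  smul_right : ∀ (a : A) x z, f x (a • z) = star a * f x z

/-- Polarization: a sesquilinear form that vanishes on the diagonal is zero. -/
theorem IsSesquilinear.eq_zero_of_diag {A V : Type*} [CommCStarAlgebra A] [AddCommGroup V]
    [Module A V] {f : V → V → A} (hf : IsSesquilinear f) (h : ∀ x, f x x = 0) (x y : V) :
    f x y = 0 := by
  -- The imaginary unit of `A`. Testing on `x + y` alone gives only `f x y + f y x = 0`; testing on
  -- `x + j • y` gives `j (f y x - f x y) = 0`, which supplies the missing symmetry.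
  set j : A := algebraMap ℂ A Complex.I with hj
  have hjj : j * j = -1 := by rw [hj, ← map_mul, Complex.I_mul_I, map_neg, map_one]
  have hjs : star j = -j := by
    rw [hj, ← algebraMap_star_comm, ← map_neg]; simp
  have h1 := h (x + y)
  have h2 := h (x + j • y)
  simp only [hf.add_left, hf.add_right, hf.smul_left, hf.smul_right, h, hjs] at h1 h2
  have h3 : (2 : ℂ) • f x y = 0 := by
    rw [two_smul]
    linear_combination h1 + j * h2 + (f x y - f y x) * hjj
  simpa using h3

/-! ### Algebra of `A`-valued inner products. -/

namespace AInnerProduct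

variable {A V : Type*} [CommCStarAlgebra A] [AddCommGroup V] [Module A V] (B : AInnerProduct A V)

theorem inner_add_left (x y z : V) : B.inner (x + y) z = B.inner x z + B.inner y z := by
  simpa using B.inner_smul_add 1 x y z

theorem inner_zero_left (z : V) : B.inner 0 z = 0 := by
  simpa using B.inner_add_left 0 0 z

theorem inner_smul_left (a : A) (x z : V) : B.inner (a • x) z = a * B.inner x z := by
  simpa [B.inner_zero_left] using B.inner_smul_add a x 0 z

theorem inner_add_right (x y z : V) : B.inner x (y + z) = B.inner x y + B.inner x z := by
  rw [B.star_inner (y + z) x, B.inner_add_left, star_add, ← B.star_inner, ← B.star_inner]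

theorem inner_smul_right (a : A) (x z : V) : B.inner x (a • z) = star a * B.inner x z := by
  rw [B.star_inner (a • z) x, B.inner_smul_left, star_mul', ← B.star_inner]

theorem inner_sub_left (x y z : V) : B.inner (x - y) z = B.inner x z - B.inner y z := by
  rw [sub_eq_add_neg, ← neg_one_smul A y, B.inner_add_left, B.inner_smul_left]
  ring

/-- A vector is determined by its inner products with all vectors. -/
theorem ext_inner {x y : V} (h : ∀ z, B.inner x z = B.inner y z) : x = y := by
  refine sub_eq_zero.1 (B.eq_zero _ fun w => ?_)
  rw [B.star_inner (x - y) w, B.inner_sub_left, h, sub_self, star_zero]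

/-- Two vectors with invertible Gram determinant are linearly independent. -/
theorem linearIndependent_of_isUnit_gram {u v : V}
    (h : IsUnit (B.inner u u * B.inner v v - B.inner u v * star (B.inner u v))) :
    LinearIndependent A ![u, v] := by
  rw [LinearIndependent.pair_iff]
  intro a b hab
  have h1 : a * B.inner u u + b * B.inner v u = 0 := by
    rw [← B.inner_smul_left, ← B.inner_smul_left, ← B.inner_add_left, hab, B.inner_zero_left]
  have h2 : a * B.inner u v + b * B.inner v v = 0 := by
    rw [← B.inner_smul_left, ← B.inner_smul_left, ← B.inner_add_left, hab, B.inner_zero_left]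
  rw [B.star_inner u v] at h1
  constructor
  -- Cramer's rule: since the Gram determinant is a unit, a coefficient vanishes as soon as its
  -- product with the determinant does, even though `A` may have zero divisors.
  · rw [← h.mul_left_eq_zero]
    linear_combination B.inner v v * h1 - star (B.inner u v) * h2
  · rw [← h.mul_left_eq_zero]
    linear_combination B.inner u u * h2 - B.inner u v * h1

end AInnerProduct

variable {A : Type*} [CommCStarAlgebra A] {n : ℕ} {M : Type*} [TopologicalSpace M]
  [ChartedSpace (EuclideanSpace ℝ (Fin n)) M] [IsManifold (𝓡 n) ∞ M] [T2Space M]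

/-! ### Multilinearity and skew-symmetry of the curvature at a point. -/

namespace AConnection

variable (D : AConnection A n M) (p : M)

/-- The chosen extension of `u + u'` may be replaced by the sum of the extensions of `u` and `u'`,
because `curvatureAt_apply` allows any extension; additivity is then that of the curvature of
fields. -/
theorem curvatureAt_add_left (u u' v w : ATangent A n p) :
    D.curvatureAt p (u + u') v w = D.curvatureAt p u v w + D.curvatureAt p u' v w := by
  have h := D.curvatureAt_apply (extend p u + extend p u') (extend p v) (extend p w) p
  have e : (extend p u + extend p u').1 p = u + u' :=
    congrArg₂ (· + ·) (extendFun_self p u) (extendFun_self p u')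
  have ev : (extend p v).1 p = v := extendFun_self p v
  have ew : (extend p w).1 p = w := extendFun_self p w
  rw [e, ev, ew, D.curvature_add_left] at h
  exact h

theorem curvatureAt_smul_left (a : A) (u v w : ATangent A n p) :
    D.curvatureAt p (a • u) v w = a • D.curvatureAt p u v w := by
  -- A constant function, so that `f • extend p u` is a smooth field with value `a • u` at `p`.
  let f : SmoothFun A n M := ⟨fun _ => a, contMDiff_const⟩
  have h := D.curvatureAt_apply (f • extend p u) (extend p v) (extend p w) p
  have e : (f • extend p u).1 p = a • u := congrArg (a • ·) (extendFun_self p u)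
  have ev : (extend p v).1 p = v := extendFun_self p v
  have ew : (extend p w).1 p = w := extendFun_self p w
  rw [e, ev, ew, D.curvature_smul_left] at h
  exact h

/-- Both sides use the same extensions, so this is the identity for fields evaluated at `p`. It
transfers the rules for the first argument to the second. -/
theorem curvatureAt_swap (u v w : ATangent A n p) :
    D.curvatureAt p u v w = - D.curvatureAt p v u w :=
  congrArg (fun X : AVectorField A n M => X.1 p) (D.curvature_swap _ _ _)

theorem curvatureAt_add_mid (u v v' w : ATangent A n p) :
    D.curvatureAt p u (v + v') w = D.curvatureAt p u v w + D.curvatureAt p u v' w := by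
  rw [curvatureAt_swap, curvatureAt_add_left, D.curvatureAt_swap p u v, D.curvatureAt_swap p u v',
    neg_add]

theorem curvatureAt_smul_mid (a : A) (u v w : ATangent A n p) :
    D.curvatureAt p u (a • v) w = a • D.curvatureAt p u v w := by
  rw [curvatureAt_swap, curvatureAt_smul_left, D.curvatureAt_swap p u v, smul_neg]

theorem curvatureAt_add_right (u v w w' : ATangent A n p) :
    D.curvatureAt p u v (w + w') = D.curvatureAt p u v w + D.curvatureAt p u v w' := by
  have h := D.curvatureAt_apply (extend p u) (extend p v) (extend p w + extend p w') p
  have e : (extend p w + extend p w').1 p = w + w' :=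
    congrArg₂ (· + ·) (extendFun_self p w) (extendFun_self p w')
  have eu : (extend p u).1 p = u := extendFun_self p u
  have ev : (extend p v).1 p = v := extendFun_self p v
  rw [e, eu, ev, D.curvature_add_right] at h
  exact h

theorem curvatureAt_smul_right (a : A) (u v w : ATangent A n p) :
    D.curvatureAt p u v (a • w) = a • D.curvatureAt p u v w := by
  let f : SmoothFun A n M := ⟨fun _ => a, contMDiff_const⟩
  have h := D.curvatureAt_apply (extend p u) (extend p v) (f • extend p w) p
  have e : (f • extend p w).1 p = a • w := congrArg (a • ·) (extendFun_self p w)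
  have eu : (extend p u).1 p = u := extendFun_self p u
  have ev : (extend p v).1 p = v := extendFun_self p v
  rw [e, eu, ev, D.curvature_smul_right] at h
  exact h

theorem curvatureAt_self (u w : ATangent A n p) : D.curvatureAt p u u w = 0 := by
  have h : (2 : ℝ) • D.curvatureAt p u u w = 0 := by
    rw [two_smul]
    exact add_eq_zero_iff_eq_neg.2 (D.curvatureAt_swap p u u w)
  simpa using h

end AConnection

/-! ### Fibres in dimension at most one. -/

/-- In dimension at most one every fibre is generated by a single vector. -/
theorem exists_forall_eq_smul (hn : n ≤ 1) (p : M) :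
    ∃ e : ATangent A n p, ∀ u, ∃ a : A, u = a • e := by
  -- The expansion `eq_sum_tmul` is about fields, so the vector is first extended to one.
  have hs (u : ATangent A n p) : u = ∑ i, act (extendFun p u) (coord A n p i) p ⊗ₜ[ℝ]
      coordVec n p i p := by
    rw [← eq_sum_tmul (extendFun p u) (mem_chart_source (EuclideanSpace ℝ (Fin n)) p),
      extendFun_self]
  interval_cases n
  · exact ⟨0, fun u => ⟨0, by rw [hs u]; simp⟩⟩
  · refine ⟨1 ⊗ₜ coordVec 1 p 0 p, fun u => ⟨act (extendFun p u) (coord A 1 p 0) p, ?_⟩⟩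
    conv_lhs => rw [hs u]
    simp [TensorProduct.smul_tmul']

/-! ### The curvature defect and its vanishing. -/

/-- The deviation `⟨R(u, v)w*, z⟩ - C (⟨u, z⟩⟨v, w⟩ - ⟨u, w⟩⟨v, z⟩)` of the curvature from that of a
space of constant curvature `C`. -/
def curvatureDefect (g : AMetric A n M) (D : AConnection A n M) (C : A) (p : M)
    (u v w z : ATangent A n p) : A :=
  (g.ip p).inner (D.curvatureAt p u v (conj w)) z -
    C * ((g.ip p).inner u z * (g.ip p).inner v w - (g.ip p).inner u w * (g.ip p).inner v z)

section Defect

variable (g : AMetric A n M) (D : AConnection A n M) (C : A) (p : M)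

/-- The defect is sesquilinear in its outer variables. -/
theorem isSesquilinear_curvatureDefect_outer (v w : ATangent A n p) :
    IsSesquilinear fun u z => curvatureDefect g D C p u v w z where
  add_left x y z := by
    simp only [curvatureDefect, D.curvatureAt_add_left, AInnerProduct.inner_add_left]; ring
  smul_left a x z := by
    simp only [curvatureDefect, D.curvatureAt_smul_left, AInnerProduct.inner_smul_left]; ring
  add_right x y z := by
    simp only [curvatureDefect, AInnerProduct.inner_add_right]; ring
  smul_right a x z := by
    simp only [curvatureDefect, AInnerProduct.inner_smul_right]; ring

/-- The defect is sesquilinear in its inner variables. -/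
theorem isSesquilinear_curvatureDefect_inner (u z : ATangent A n p) :
    IsSesquilinear fun v w => curvatureDefect g D C p u v w z where
  add_left x y w := by
    simp only [curvatureDefect, D.curvatureAt_add_mid, AInnerProduct.inner_add_left]; ring
  smul_left a x w := by
    simp only [curvatureDefect, D.curvatureAt_smul_mid, AInnerProduct.inner_smul_left]; ring
  add_right x y w := by
    simp only [curvatureDefect, map_add, D.curvatureAt_add_right, AInnerProduct.inner_add_left,
      AInnerProduct.inner_add_right]; ring
  -- The defect contains `R(u, v)w*`, and the involution turns `a • w` into `star a • w*`; this
  -- makes the curvature term conjugate linear in `w`, like the metric terms.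
  smul_right a x w := by
    simp only [curvatureDefect, conj_smul, D.curvatureAt_smul_right, AInnerProduct.inner_smul_left,
      AInnerProduct.inner_smul_right]; ring

variable {g D C p}

/-- Invertibility of `Q(u, v)` makes `u, v` a basis of their span, which is therefore a
non-degenerate plane. The curvature hypothesis applies to this very basis, and multiplying out the
denominator gives `⟨R(u, v)v*, u⟩ = C Q(u, v)`. -/
theorem curvatureDefect_eq_zero_of_isUnit (hC : g.HasConstantCurvature D C)
    {u v : ATangent A n p} (h : IsUnit (g.Q p u v)) : curvatureDefect g D C p u v v u = 0 := by
  have hli := (g.ip p).linearIndependent_of_isUnit_gram h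
  let b := Module.Basis.span hli
  have h0 : (b 0 : ATangent A n p) = u := by simp [b, Module.Basis.span_apply]
  have h1 : (b 1 : ATangent A n p) = v := by simp [b, Module.Basis.span_apply]
  have hK := hC p _ ⟨b, by rwa [h0, h1]⟩ b
  rw [h0, h1, AMetric.sectionalCurvature] at hK
  have hR : (g.ip p).inner (D.curvatureAt p u v (conj v)) u = C * g.Q p u v := by
    rw [← hK, mul_assoc, Ring.inverse_mul_cancel _ h, mul_one]
  rw [curvatureDefect, hR, AMetric.Q, ← (g.ip p).star_inner]
  ring

/-- If one pair of vectors has invertible `Q`, then the defect vanishes on all pairs: along a real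
line through the given pair it is a polynomial that vanishes near that pair. -/
theorem curvatureDefect_diag_eq_zero (hC : g.HasConstantCurvature D C)
    {u₀ v₀ : ATangent A n p} (h : IsUnit (g.Q p u₀ v₀)) (u v : ATangent A n p) :
    curvatureDefect g D C p u v v u = 0 := by
  -- The inclusion of the real scalars, bundled as a continuous linear map so that its continuity
  -- and analyticity are at hand. Its values are self-adjoint, so conjugate linearity brings out the
  -- same factor `L t` as linearity.
  let L : ℝ →L[ℝ] A := (Algebra.linearMap ℝ A).toContinuousLinearMap
  have hL (t : ℝ) : star (L t) = L t := by
    change star (algebraMap ℝ A t) = algebraMap ℝ A t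
    rw [← algebraMap_star_comm]; simp
  have hL0 : L 0 = 0 := map_zero L
  have hL1 : L 1 = 1 := map_one (algebraMap ℝ A)
  let x (t : ℝ) : ATangent A n p := u₀ + L t • (u - u₀)
  let y (t : ℝ) : ATangent A n p := v₀ + L t • (v - v₀)
  have hx0 : x 0 = u₀ := by simp [x, hL0]
  have hy0 : y 0 = v₀ := by simp [y, hL0]
  have hx1 : x 1 = u := by simp [x, hL1]
  have hy1 : y 1 = v := by simp [y, hL1]
  have hQ : Continuous fun t => g.Q p (x t) (y t) := by
    simp only [AMetric.Q, x, y, AInnerProduct.inner_add_left, AInnerProduct.inner_add_right,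
      AInnerProduct.inner_smul_left, AInnerProduct.inner_smul_right]
    fun_prop
  have hF : AnalyticOnNhd ℝ (fun t => curvatureDefect g D C p (x t) (y t) (y t) (x t))
      Set.univ := by
    intro t _
    have ho := isSesquilinear_curvatureDefect_outer g D C p
    have hi := isSesquilinear_curvatureDefect_inner g D C p
    -- After expansion only powers of `L t` with constant coefficients in `A` remain, so no topology
    -- on the fibre is involved.
    simp only [x, y, (ho _ _).add_left, (ho _ _).add_right, (ho _ _).smul_left,
      (ho _ _).smul_right, (hi _ _).add_left, (hi _ _).add_right, (hi _ _).smul_left,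
      (hi _ _).smul_right, hL]
    have hLa : AnalyticAt ℝ (fun t => L t) t := L.analyticAt t
    fun_prop
  have hz : (fun t => curvatureDefect g D C p (x t) (y t) (y t) (x t)) =ᶠ[𝓝 0] fun _ => 0 := by
    have hU : ∀ᶠ t in 𝓝 (0 : ℝ), IsUnit (g.Q p (x t) (y t)) :=
      -- Units are open in the Banach algebra `A`, and `Q` is a unit at `t = 0`.
      hQ.continuousAt.eventually (Units.isOpen.mem_nhds (by
        simpa only [hx0, hy0, Set.mem_ofPred_eq] using h))
    filter_upwards [hU] with t ht
    exact curvatureDefect_eq_zero_of_isUnit hC ht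
  -- Identity theorem on the connected line, read off at `t = 1`, where the pair is `(u, v)`.
  have := congrFun (hF.eq_of_eventuallyEq analyticOnNhd_const hz) 1
  simpa only [hx1, hy1] using this

/-- If one pair of vectors has invertible `Q`, then the defect vanishes identically. Since
`A` contains the imaginary unit, this is polarization alone: no symmetry of the curvature tensor
beyond its sesquilinearity is needed. -/
theorem curvatureDefect_eq_zero (hC : g.HasConstantCurvature D C)
    {u₀ v₀ : ATangent A n p} (h : IsUnit (g.Q p u₀ v₀)) (u v w z : ATangent A n p) :
    curvatureDefect g D C p u v w z = 0 :=
  -- Polarizing in `(v, w)` with `u, z` fixed reduces to `w = v`; polarizing in `(u, z)` then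
  -- reduces to `z = u`.
  (isSesquilinear_curvatureDefect_inner g D C p u z).eq_zero_of_diag (fun v =>
    (isSesquilinear_curvatureDefect_outer g D C p v v).eq_zero_of_diag
      (fun u => curvatureDefect_diag_eq_zero hC h u v) u z) v w

end Defect

end OpMetric

end

/-! ### The main theorem. -/

theorem corollary9p4 {A : Type*} [CommCStarAlgebra A] {n : ℕ} {M : Type*} [TopologicalSpace M]
    [ChartedSpace (EuclideanSpace ℝ (Fin n)) M] [IsManifold (𝓡 n) ∞ M] [T2Space M]
    (g : OpMetric.AMetric A n M) (D : OpMetric.AConnection A n M) (hD : D.IsLeviCivita g)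
    (hP : 2 ≤ n → ∀ p : M, ∃ P : Submodule A (OpMetric.ATangent A n p),
      g.IsNondegeneratePlane p P)
    (C : A) (hC : g.HasConstantCurvature D C)
    (p : M) (u v w : OpMetric.ATangent A n p) :
    D.curvatureAt p u v w =
      C • ((g.ip p).inner v (OpMetric.conj w) • u - (g.ip p).inner u (OpMetric.conj w) • v) := by
  rcases le_or_gt 2 n with hn | hn
  · obtain ⟨P, b, hb⟩ := hP hn p
    refine (g.ip p).ext_inner fun z => sub_eq_zero.1 ?_
    -- The defect already applies the involution to its third argument, so it is evaluated at `w*`.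
    have h := OpMetric.curvatureDefect_eq_zero hC hb u v (OpMetric.conj w) z
    rw [OpMetric.curvatureDefect, OpMetric.conj_conj] at h
    rw [← h, OpMetric.AInnerProduct.inner_smul_left, OpMetric.AInnerProduct.inner_sub_left,
      OpMetric.AInnerProduct.inner_smul_left, OpMetric.AInnerProduct.inner_smul_left]
    ring
  · obtain ⟨e, he⟩ := OpMetric.exists_forall_eq_smul (A := A) (by omega : n ≤ 1) p
    obtain ⟨a, rfl⟩ := he u
    obtain ⟨b, rfl⟩ := he v
    -- With `u = a • e` and `v = b • e` the left side is `ab R(e, e)w = 0`, and the two terms on the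
    -- right cancel.
    rw [D.curvatureAt_smul_left, D.curvatureAt_smul_mid, D.curvatureAt_self,
      OpMetric.AInnerProduct.inner_smul_left, OpMetric.AInnerProduct.inner_smul_left]
    module
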